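/- For a tensor $\mathcal A\in\mathbb R^{n_1\times n_2\times n_3}$ with frontal slices $A^{(0)},\dots,A^{(n_3-1)}\in\mathbb R^{n_1\times n_2}$ let $\operatorname{bcirc}(\mathcal A)\in\mathbb R^{n_1n_3\times n_2n_3}$ be the block circulant matrix whose block in position $(k,l)$ is $A^{((k-l)\bmod n_3)}$, $0\le k,l<n_3$, and let the tensor spectral norm $\|\mathcal A\|$ be the spectral norm (largest singular value) of $\operatorname{bcirc}(\mathcal A)$. (Equivalently, it is the largest spectral norm of a frontal slice of the discrete Fourier transform of $\mathcal A$ along the third dimension.) For every $c>0$ there is a function $\varphi$, depending only on $c$, with $\lim_{\rho\to0^+}\varphi(\rho)=0$, such that the following holds. Let $0<\rho\le 1$, let $n,n_3\ge1$ be integers, and let $\mathcal M\in\mathbb R^{n\times n\times n_3}$ be a random tensor with independent entries, each equal to $1$ with probability $\rho/2$, to $-1$ with probability $\rho/2$, and to $0$ with probability $1-\rho$. Then $$\mathbb P\bigl(\|\mathcal M\|\le\varphi(\rho)\sqrt{n\,n_3}\bigr)\ \ge\ 1-n_3\,e^{-cn}.$$ -/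

import Mathlib

open MeasureTheory ProbabilityTheory Filter Topology

/-- Real tensors of size `n₁ × n₂ × n₃`; `A i j k` is the entry in row `i`, column `j` of the
`k`-th frontal slice. -/
abbrev Tensor3 (n₁ n₂ n₃ : ℕ) : Type := Fin n₁ → Fin n₂ → Fin n₃ → ℝ

/-- The block circulant matrix of size `n₁n₃ × n₂n₃` of a tensor: its block in block row `k` and
block column `l` is the frontal slice with number `k - l` modulo `n₃`
(subtraction in `Fin n₃` is modulo `n₃`). -/
def bcirc {n₁ n₂ n₃ : ℕ} (A : Tensor3 n₁ n₂ n₃) :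
    Matrix (Fin n₃ × Fin n₁) (Fin n₃ × Fin n₂) ℝ :=
  Matrix.of fun p q => A p.2 q.2 (p.1 - q.1)

open scoped Matrix.Norms.L2Operator in
/-- The tensor spectral norm: the spectral norm (the operator norm for Euclidean norms,
that is, the largest singular value) of the block circulant matrix. -/
noncomputable def tensorSpectralNorm {n₁ n₂ n₃ : ℕ} (A : Tensor3 n₁ n₂ n₃) : ℝ :=
  ‖bcirc A‖

/-- `M` is a random tensor with independent entries, each equal to `1` with probability `ρ / 2`,
to `-1` with probability `ρ / 2`, and to `0` with probability `1 - ρ`. -/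
structure IsBernoulliSignTensor {Ω : Type*} [MeasurableSpace Ω] (μ : Measure Ω)
    {n₁ n₂ n₃ : ℕ} (ρ : ℝ) (M : Ω → Tensor3 n₁ n₂ n₃) : Prop where
  measurable_entry : ∀ i j k, Measurable fun ω => M ω i j k
  indep : iIndepFun (fun (p : Fin n₁ × Fin n₂ × Fin n₃) (ω : Ω) => M ω p.1 p.2.1 p.2.2) μ
  prob_one : ∀ i j k, μ.real {ω | M ω i j k = 1} = ρ / 2
  prob_neg_one : ∀ i j k, μ.real {ω | M ω i j k = -1} = ρ / 2
  prob_zero : ∀ i j k, μ.real {ω | M ω i j k = 0} = 1 - ρ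

/-! The Fourier transform along the third dimension block-diagonalises `bcirc`, so it suffices to
bound the real matrices `∑ k, a k • A k`, with `a` the real or imaginary part of a character, hence
`|a k| ≤ 1` (`tensorSpectralNorm_le`). Half-nets reduce each operator norm to at most `25 ^ n`
bilinear forms in independent entries.

Each form is subgaussian with proxy `n₃ * K`, where `K = sparseSignProxy ρ`. The decisive point is
that `K` tends to `0` with `ρ` (`one_sub_add_mul_cosh_le`); Hoeffding's bound for entries in `[-1,
1]` would only give `K = 1`. At level `β ^ 2 = 2 * (c + 4) * K * n * n₃` each tail is `exp (-(c + 4)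
* n)`, which beats the union bound over `2 * n₃ * 25 ^ n` events. -/

/-! ### Nets and operator norms -/

theorem exists_half_net (E : Type*) [NormedAddCommGroup E] [NormedSpace ℝ E]
    [FiniteDimensional ℝ E] :
    ∃ s : Finset E, s.card ≤ 5 ^ Module.finrank ℝ E ∧ (∀ c ∈ s, ‖c‖ ≤ 1) ∧
      ∀ x : E, ‖x‖ ≤ 1 → ∃ c ∈ s, ‖x - c‖ ≤ 1 / 2 := by
  classical
  -- A largest 1-separated subset of the ball of radius 2 covers that ball at distance 1; halving it
  -- gives the net. This scale is the one of the Besicovitch bound `5 ^ d`.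
  let P : Finset E → Prop := fun s =>
    (∀ c ∈ s, ‖c‖ ≤ 2) ∧ ∀ c ∈ s, ∀ d ∈ s, c ≠ d → 1 ≤ ‖c - d‖
  have hbdd : BddAbove {k : ℕ | ∃ s : Finset E, P s ∧ s.card = k} := by
    refine ⟨5 ^ Module.finrank ℝ E, ?_⟩
    rintro k ⟨s, hs, rfl⟩
    exact Besicovitch.card_le_of_separated s hs.1 hs.2
  have hne : {k : ℕ | ∃ s : Finset E, P s ∧ s.card = k}.Nonempty :=
    ⟨0, ∅, ⟨by simp, by simp⟩, by simp⟩
  obtain ⟨s, hs, hcard⟩ := Nat.sSup_mem hne hbdd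
  refine ⟨s.image fun c => (1 / 2 : ℝ) • c,
    Finset.card_image_le.trans (Besicovitch.card_le_of_separated s hs.1 hs.2), ?_, ?_⟩
  · simp only [Finset.mem_image]
    rintro _ ⟨c, hc, rfl⟩
    have := hs.1 c hc
    rw [norm_smul]
    norm_num
    linarith
  · intro x hx
    suffices ∃ c ∈ s, ‖(2 : ℝ) • x - c‖ ≤ 1 by
      obtain ⟨c, hc, h⟩ := this
      refine ⟨_, Finset.mem_image_of_mem _ hc, ?_⟩
      have e : x - (1 / 2 : ℝ) • c = (1 / 2 : ℝ) • ((2 : ℝ) • x - c) := by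
        rw [smul_sub, smul_smul]; norm_num
      rw [e, norm_smul]
      norm_num
      linarith
    by_contra! hfar
    have hx2 : ‖(2 : ℝ) • x‖ ≤ 2 := by
      rw [norm_smul]; norm_num; linarith
    have hnot : (2 : ℝ) • x ∉ s := fun hmem => by
      have := hfar _ hmem
      norm_num at this
    have hins : P (insert ((2 : ℝ) • x) s) := by
      refine ⟨?_, ?_⟩
      · intro c hc
        rcases Finset.mem_insert.1 hc with rfl | hc
        exacts [hx2, hs.1 c hc]
      · intro c hc d hd hcd
        rcases Finset.mem_insert.1 hc with rfl | hc <;> rcases Finset.mem_insert.1 hd with rfl | hd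
        · exact absurd rfl hcd
        · exact (hfar d hd).le
        · rw [norm_sub_rev]; exact (hfar c hc).le
        · exact hs.2 c hc d hd hcd
    have := le_csSup hbdd ⟨_, hins, rfl⟩
    rw [Finset.card_insert_of_notMem hnot, hcard] at this
    omega

/-- Replacing `w / ‖w‖` by a nearby net point costs at most half of `‖w‖`. -/
theorem norm_le_two_mul_of_net {E : Type*} [NormedAddCommGroup E] [InnerProductSpace ℝ E]
    {s : Finset E} (hnet : ∀ x : E, ‖x‖ ≤ 1 → ∃ c ∈ s, ‖x - c‖ ≤ 1 / 2)
    {β : ℝ} (hβ : 0 ≤ β) {w : E} (h : ∀ u ∈ s, inner ℝ u w ≤ β) : ‖w‖ ≤ 2 * β := by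
  by_cases hw : w = 0
  · simp [hw, hβ]
  have hpos : 0 < ‖w‖ := norm_pos_iff.2 hw
  obtain ⟨c, hc, hxc⟩ := hnet (‖w‖⁻¹ • w) (by rw [norm_smul, norm_inv, norm_norm]; field_simp; rfl)
  have h1 : inner ℝ (‖w‖⁻¹ • w) w = ‖w‖ := by
    rw [real_inner_smul_left, real_inner_self_eq_norm_sq]; field_simp
  have h2 : inner ℝ (‖w‖⁻¹ • w - c) w ≤ 1 / 2 * ‖w‖ :=
    (real_inner_le_norm _ _).trans (by gcongr)
  rw [inner_sub_left, h1] at h2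
  linarith [h c hc]

theorem opNorm_le_two_mul_of_net {E F : Type*} [NormedAddCommGroup E] [NormedSpace ℝ E]
    [NormedAddCommGroup F] [NormedSpace ℝ F]
    {s : Finset E} (hnet : ∀ x : E, ‖x‖ ≤ 1 → ∃ c ∈ s, ‖x - c‖ ≤ 1 / 2)
    {β : ℝ} (hβ : 0 ≤ β) {T : E →L[ℝ] F} (h : ∀ v ∈ s, ‖T v‖ ≤ β) : ‖T‖ ≤ 2 * β := by
  suffices ‖T‖ ≤ β + ‖T‖ / 2 by linarith
  refine ContinuousLinearMap.opNorm_le_of_unit_norm (by positivity) fun x hx => ?_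
  obtain ⟨c, hc, hxc⟩ := hnet x hx.le
  calc ‖T x‖ = ‖T c + T (x - c)‖ := by rw [← map_add]; simp
    _ ≤ ‖T c‖ + ‖T‖ * ‖x - c‖ := (norm_add_le _ _).trans (by gcongr; exact T.le_opNorm _)
    _ ≤ β + ‖T‖ * (1 / 2) := by gcongr; exact h c hc
    _ = β + ‖T‖ / 2 := by ring

/-! ### Plancherel and convolution on a finite abelian group -/

section Fourier

variable {G : Type*} [AddCommGroup G] [Fintype G]

/-- The real part of the Fourier transform at the character `ψ`. -/
noncomputable def cosTransform {V : Type*} [AddCommGroup V] [Module ℝ V] (f : G → V)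
    (ψ : AddChar G ℂ) : V := ∑ k, (ψ k).re • f k

/-- The imaginary part of the Fourier transform at the character `ψ`. -/
noncomputable def sinTransform {V : Type*} [AddCommGroup V] [Module ℝ V] (f : G → V)
    (ψ : AddChar G ℂ) : V := ∑ k, (ψ k).im • f k

/-- Character orthogonality: the summand is the real part of `ψ (k - l)`. -/
theorem sum_re_mul_re_add_im_mul_im [DecidableEq G] (k l : G) :
    ∑ ψ : AddChar G ℂ, ((ψ k).re * (ψ l).re + (ψ k).im * (ψ l).im) =
      if k = l then (Fintype.card G : ℝ) else 0 := by
  have h := congrArg Complex.re (AddChar.sum_apply_eq_ite (k - l))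
  rw [Complex.re_sum] at h
  convert h using 1
  · refine Finset.sum_congr rfl fun ψ _ => ?_
    rw [sub_eq_add_neg, AddChar.map_add_eq_mul, AddChar.map_neg_eq_conj]
    simp
  · simp only [sub_eq_zero]
    split_ifs <;> simp

theorem sum_norm_sq_transform {E : Type*} [NormedAddCommGroup E] [InnerProductSpace ℝ E]
    (f : G → E) :
    ∑ ψ : AddChar G ℂ, (‖cosTransform f ψ‖ ^ 2 + ‖sinTransform f ψ‖ ^ 2) =
      Fintype.card G * ∑ k, ‖f k‖ ^ 2 := by
  classical
  have expand : ∀ a : G → ℝ, ‖∑ k, a k • f k‖ ^ 2 = ∑ k, ∑ l, a k * a l * inner ℝ (f k) (f l) := by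
    intro a
    rw [← real_inner_self_eq_norm_sq, sum_inner]
    refine Finset.sum_congr rfl fun k _ => ?_
    rw [inner_sum]
    refine Finset.sum_congr rfl fun l _ => ?_
    rw [real_inner_smul_left, real_inner_smul_right, mul_assoc]
  simp only [cosTransform, sinTransform, expand, ← Finset.sum_add_distrib, ← add_mul]
  rw [Finset.sum_comm, Finset.mul_sum]
  refine Finset.sum_congr rfl fun k _ => ?_
  rw [Finset.sum_comm]
  simp only [← Finset.sum_mul, sum_re_mul_re_add_im_mul_im]
  simp

variable {E F : Type*} [NormedAddCommGroup E] [InnerProductSpace ℝ E]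
  [NormedAddCommGroup F] [InnerProductSpace ℝ F]

/-- The hypothesis is an abstract addition formula, so one computation serves both cosine and sine.
-/
theorem sum_smul_convolution (a : G → ℝ) (b c d e : G → ℝ)
    (h : ∀ k l, a (k + l) = b k * c l + d k * e l) (A : G → E →L[ℝ] F) (x : G → E) :
    ∑ k, a k • ∑ l, A (k - l) (x l) =
      (∑ k, b k • A k) (∑ l, c l • x l) + (∑ k, d k • A k) (∑ l, e l • x l) := by
  simp only [map_sum, sum_apply, smul_apply, map_smul,
    Finset.smul_sum]
  rw [Finset.sum_comm, ← Finset.sum_add_distrib]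
  refine Finset.sum_congr rfl fun l _ => ?_
  rw [← Finset.sum_add_distrib, ← Equiv.sum_comp (Equiv.addRight l) fun k => a k • A (k - l) (x l)]
  refine Finset.sum_congr rfl fun k _ => ?_
  simp only [Equiv.coe_addRight, add_sub_cancel_right, h, smul_smul, add_smul]
  congr 2 <;> ring

/-- By Plancherel on both sides the bound can be checked at each character, where convolution
becomes a complex product. -/
theorem sum_norm_sq_convolution_le (A : G → E →L[ℝ] F) (x : G → E) {β : ℝ}
    (hc : ∀ ψ, ‖cosTransform A ψ‖ ≤ β) (hs : ∀ ψ, ‖sinTransform A ψ‖ ≤ β) :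
    ∑ k, ‖∑ l, A (k - l) (x l)‖ ^ 2 ≤ (2 * β) ^ 2 * ∑ k, ‖x k‖ ^ 2 := by
  have hβ : 0 ≤ β := (norm_nonneg _).trans (hc 0)
  have hG : (0 : ℝ) < Fintype.card G := by exact_mod_cast Fintype.card_pos
  refine le_of_mul_le_mul_left ?_ hG
  rw [mul_left_comm, ← sum_norm_sq_transform, ← sum_norm_sq_transform, Finset.mul_sum]
  refine Finset.sum_le_sum fun ψ _ => ?_
  have hre : cosTransform (fun k => ∑ l, A (k - l) (x l)) ψ =
      cosTransform A ψ (cosTransform x ψ) + sinTransform A ψ (-sinTransform x ψ) := by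
    have := sum_smul_convolution (fun k => (ψ k).re) (fun k => (ψ k).re) (fun k => (ψ k).re)
      (fun k => (ψ k).im) (fun k => -(ψ k).im)
      (fun k l => by simp [AddChar.map_add_eq_mul, Complex.mul_re, sub_eq_add_neg]) A x
    simpa [cosTransform, sinTransform] using this
  have him : sinTransform (fun k => ∑ l, A (k - l) (x l)) ψ =
      cosTransform A ψ (sinTransform x ψ) + sinTransform A ψ (cosTransform x ψ) :=
    sum_smul_convolution (fun k => (ψ k).im) (fun k => (ψ k).re) (fun k => (ψ k).im)
      (fun k => (ψ k).im) (fun k => (ψ k).re)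
      (fun k l => by simp [AddChar.map_add_eq_mul, Complex.mul_im]) A x
  have key : ∀ u v : E, ‖cosTransform A ψ u + sinTransform A ψ v‖ ≤ β * (‖u‖ + ‖v‖) := by
    intro u v
    rw [mul_add]
    exact (norm_add_le _ _).trans (add_le_add
      (ContinuousLinearMap.le_of_opNorm_le _ (hc ψ) u)
      (ContinuousLinearMap.le_of_opNorm_le _ (hs ψ) v))
  have k1 := pow_le_pow_left₀ (norm_nonneg _) (key (cosTransform x ψ) (-sinTransform x ψ)) 2
  have k2 := pow_le_pow_left₀ (norm_nonneg _) (key (sinTransform x ψ) (cosTransform x ψ)) 2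
  rw [hre, him]
  rw [norm_neg] at k1
  -- With `p`, `q` the two norms: `2 * β² * (p + q)² ≤ 4 * β² * (p² + q²)`, whence the factor `2 *
  -- β`.
  nlinarith [mul_nonneg (sq_nonneg β) (sq_nonneg (‖cosTransform x ψ‖ - ‖sinTransform x ψ‖))]

end Fourier

/-! ### From the block circulant matrix to bilinear forms -/

/-- The `k`-th frontal slice as a linear map between Euclidean spaces. -/
noncomputable def frontalSliceCLM {n₁ n₂ n₃ : ℕ} (A : Tensor3 n₁ n₂ n₃) (k : Fin n₃) :
    EuclideanSpace ℝ (Fin n₂) →L[ℝ] EuclideanSpace ℝ (Fin n₁) :=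
  LinearMap.toContinuousLinearMap
    (Matrix.toEuclideanLin (Matrix.of fun i j => A i j k))

theorem frontalSliceCLM_apply {n₁ n₂ n₃ : ℕ} (A : Tensor3 n₁ n₂ n₃) (k : Fin n₃)
    (v : EuclideanSpace ℝ (Fin n₂)) (i : Fin n₁) :
    frontalSliceCLM A k v i = ∑ j, A i j k * v j := by
  simp [frontalSliceCLM, Matrix.toLpLin_apply, Matrix.mulVec, dotProduct]

/-- `bcirc A` acts as cyclic convolution with the frontal slices. -/
theorem tensorSpectralNorm_le {n₁ n₂ n₃ : ℕ} [NeZero n₃] (A : Tensor3 n₁ n₂ n₃) {β : ℝ}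
    (hc : ∀ ψ, ‖cosTransform (frontalSliceCLM A) ψ‖ ≤ β)
    (hs : ∀ ψ, ‖sinTransform (frontalSliceCLM A) ψ‖ ≤ β) :
    tensorSpectralNorm A ≤ 2 * β := by
  have hβ : 0 ≤ β := (norm_nonneg _).trans (hc 0)
  rw [tensorSpectralNorm, Matrix.l2_opNorm_def]
  refine ContinuousLinearMap.opNorm_le_bound _ (by positivity) fun x => ?_
  refine abs_le_of_sq_le_sq' ?_ (by positivity) |>.2
  have h := sum_norm_sq_convolution_le (frontalSliceCLM A)
    (fun l => WithLp.toLp 2 fun j => x (l, j)) hc hs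
  simp only [EuclideanSpace.norm_sq_eq, mul_pow] at h ⊢
  rw [Fintype.sum_prod_type, Fintype.sum_prod_type]
  refine le_of_eq_of_le ?_ h
  refine Finset.sum_congr rfl fun k _ => Finset.sum_congr rfl fun i _ => ?_
  congr 2
  simp [Matrix.toLpLin_apply, Matrix.mulVec, dotProduct, Fintype.sum_prod_type, bcirc,
    frontalSliceCLM_apply]

theorem inner_sum_smul_frontalSliceCLM {n₁ n₂ n₃ : ℕ} (A : Tensor3 n₁ n₂ n₃) (a : Fin n₃ → ℝ)
    (u : EuclideanSpace ℝ (Fin n₁)) (v : EuclideanSpace ℝ (Fin n₂)) :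
    inner ℝ u ((∑ k, a k • frontalSliceCLM A k) v) =
      ∑ p : Fin n₁ × Fin n₂ × Fin n₃, (u p.1 * v p.2.1 * a p.2.2) * A p.1 p.2.1 p.2.2 := by
  simp only [sum_apply, smul_apply, inner_sum, inner_smul_right,
    PiLp.inner_apply, frontalSliceCLM_apply, Fintype.sum_prod_type, RCLike.inner_apply, conj_trivial]
  simp only [Finset.mul_sum, Finset.sum_mul]
  rw [Finset.sum_comm]
  refine Finset.sum_congr rfl fun i _ => ?_
  rw [Finset.sum_comm]
  refine Finset.sum_congr rfl fun j _ => Finset.sum_congr rfl fun k _ => ?_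
  ring

theorem tensorSpectralNorm_le_of_net {n₁ n₂ n₃ : ℕ} [NeZero n₃] (A : Tensor3 n₁ n₂ n₃) {β : ℝ}
    (hβ : 0 ≤ β) {s : Finset (EuclideanSpace ℝ (Fin n₁))} {t : Finset (EuclideanSpace ℝ (Fin n₂))}
    (hs : ∀ x, ‖x‖ ≤ 1 → ∃ c ∈ s, ‖x - c‖ ≤ 1 / 2) (ht : ∀ x, ‖x‖ ≤ 1 → ∃ c ∈ t, ‖x - c‖ ≤ 1 / 2)
    (hre : ∀ ψ : AddChar (Fin n₃) ℂ, ∀ u ∈ s, ∀ v ∈ t, ∑ p : Fin n₁ × Fin n₂ × Fin n₃,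
      (u p.1 * v p.2.1 * (ψ p.2.2).re) * A p.1 p.2.1 p.2.2 ≤ β)
    (him : ∀ ψ : AddChar (Fin n₃) ℂ, ∀ u ∈ s, ∀ v ∈ t, ∑ p : Fin n₁ × Fin n₂ × Fin n₃,
      (u p.1 * v p.2.1 * (ψ p.2.2).im) * A p.1 p.2.1 p.2.2 ≤ β) :
    tensorSpectralNorm A ≤ 8 * β := by
  -- Each net costs a factor 2; recombining real and imaginary parts costs the third.
  have h (a : Fin n₃ → ℝ) (ha : ∀ u ∈ s, ∀ v ∈ t, ∑ p : Fin n₁ × Fin n₂ × Fin n₃,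
      (u p.1 * v p.2.1 * a p.2.2) * A p.1 p.2.1 p.2.2 ≤ β) :
      ‖∑ k, a k • frontalSliceCLM A k‖ ≤ 2 * (2 * β) :=
    opNorm_le_two_mul_of_net ht (by positivity) fun v hv =>
      norm_le_two_mul_of_net hs hβ fun u hu => by
        rw [inner_sum_smul_frontalSliceCLM]
        exact ha u hu v hv
  refine (tensorSpectralNorm_le A (fun ψ => h _ (hre ψ)) (fun ψ => h _ (him ψ))).trans_eq ?_
  ring

/-! ### Subgaussian proxy of a sparse sign -/

/-- A variance proxy for a random sign that is nonzero with probability `ρ`. -/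
noncomputable def sparseSignProxy (ρ : ℝ) : ℝ :=
  2 * Real.exp (Real.log ρ / 2) + 2 / √(1 - Real.log ρ)

theorem sparseSignProxy_pos (ρ : ℝ) : 0 < sparseSignProxy ρ := by
  unfold sparseSignProxy; positivity

theorem tendsto_sparseSignProxy : Tendsto sparseSignProxy (𝓝[>] 0) (𝓝 0) := by
  have hlog : Tendsto Real.log (𝓝[>] 0) atBot := Real.tendsto_log_nhdsGT_zero
  have h1 : Tendsto (fun ρ => Real.exp (Real.log ρ / 2)) (𝓝[>] 0) (𝓝 0) :=
    Real.tendsto_exp_atBot.comp (hlog.atBot_div_const two_pos)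
  have h2 : Tendsto (fun ρ => √(1 - Real.log ρ)) (𝓝[>] 0) atTop :=
    Real.tendsto_sqrt_atTop.comp
      (tendsto_atTop_add_const_left _ 1 (tendsto_neg_atBot_atTop.comp hlog))
  have h := (h1.const_mul 2).add (h2.const_div_atTop 2)
  rwa [mul_zero, add_zero] at h

/-- The left side is the moment generating function of an entry. Put `L = 1 - log ρ`. If `t ^ 2 ≤
L`, then `cosh t - 1 ≤ y * exp y` with `y = t ^ 2 / 2`, and `ρ * exp y ≤ √(e * ρ) ≤ 2 * √ρ`: the
first term of the proxy. Otherwise `√L ≤ |t|`, so `cosh t ≤ exp |t| ≤ exp (t ^ 2 / √L)`: the second.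
-/
theorem one_sub_add_mul_cosh_le {ρ : ℝ} (h0 : 0 < ρ) (h1 : ρ ≤ 1) (t : ℝ) :
    1 - ρ + ρ * Real.cosh t ≤ Real.exp (sparseSignProxy ρ * t ^ 2 / 2) := by
  have hlog : Real.log ρ ≤ 0 := Real.log_nonpos h0.le h1
  have hL : 0 < 1 - Real.log ρ := by linarith
  have hsq : 0 < √(1 - Real.log ρ) := Real.sqrt_pos.2 hL
  by_cases ht : t ^ 2 ≤ 1 - Real.log ρ
  · set y := t ^ 2 / 2 with hy
    have hexp : Real.exp y - 1 ≤ y * Real.exp y := by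
      have := Real.add_one_le_exp (-y)
      have h2 := mul_le_mul_of_nonneg_right this (Real.exp_pos y).le
      rw [← Real.exp_add] at h2
      simp at h2
      linarith
    have hcosh : Real.cosh t - 1 ≤ y * Real.exp y := by
      linarith [Real.cosh_le_exp_half_sq t]
    have hρ : ρ * Real.exp y ≤ 2 * Real.exp (Real.log ρ / 2) := by
      calc ρ * Real.exp y = Real.exp (Real.log ρ + y) := by rw [Real.exp_add, Real.exp_log h0]
        _ ≤ Real.exp (1 / 2 + Real.log ρ / 2) := Real.exp_le_exp.2 (by linarith)
        _ = Real.exp (1 / 2) * Real.exp (Real.log ρ / 2) := Real.exp_add _ _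
        _ ≤ 2 * Real.exp (Real.log ρ / 2) := by
          gcongr
          have := Real.exp_one_lt_d9
          have h3 : Real.exp (1 / 2) ^ 2 = Real.exp 1 := by rw [← Real.exp_nat_mul]; norm_num
          nlinarith [Real.exp_pos (1 / 2 : ℝ)]
    calc 1 - ρ + ρ * Real.cosh t = 1 + ρ * (Real.cosh t - 1) := by ring
      _ ≤ 1 + ρ * (y * Real.exp y) := by gcongr
      _ = (ρ * Real.exp y) * y + 1 := by ring
      _ ≤ sparseSignProxy ρ * y + 1 := by
        gcongr
        exact hρ.trans (le_add_of_nonneg_right (by positivity))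
      _ ≤ Real.exp (sparseSignProxy ρ * y) := Real.add_one_le_exp _
      _ = Real.exp (sparseSignProxy ρ * t ^ 2 / 2) := by rw [hy]; ring_nf
  · have habs : √(1 - Real.log ρ) ≤ |t| := Real.sqrt_le_iff.2 ⟨abs_nonneg t, by
      rw [sq_abs]; linarith⟩
    have hcosh : Real.cosh t ≤ Real.exp |t| := by
      rw [Real.cosh_eq]
      linarith [Real.exp_le_exp.2 (le_abs_self t), Real.exp_le_exp.2 (neg_le_abs t)]
    calc 1 - ρ + ρ * Real.cosh t ≤ Real.cosh t := by nlinarith [Real.one_le_cosh t]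
      _ ≤ Real.exp |t| := hcosh
      _ ≤ Real.exp (sparseSignProxy ρ * t ^ 2 / 2) := by
        refine Real.exp_le_exp.2 ?_
        calc |t| ≤ t ^ 2 / √(1 - Real.log ρ) := by
              rw [le_div_iff₀ hsq, ← sq_abs, sq]; gcongr
          _ = 2 / √(1 - Real.log ρ) * t ^ 2 / 2 := by ring
          _ ≤ sparseSignProxy ρ * t ^ 2 / 2 := by
            gcongr
            exact le_add_of_nonneg_left (by positivity)

theorem ProbabilityTheory.HasSubgaussianMGF.mono_const {Ω : Type*} [MeasurableSpace Ω] {μ : Measure Ω}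
    {X : Ω → ℝ} {c d : NNReal} (h : HasSubgaussianMGF X c μ)
    (hcd : c ≤ d) : HasSubgaussianMGF X d μ :=
  ⟨h.integrable_exp_mul, fun t => (h.mgf_le t).trans (by gcongr)⟩

/-! ### Tail of one bilinear form -/

section Subgaussian

variable {Ω : Type*} [MeasurableSpace Ω] {μ : Measure Ω} [IsProbabilityMeasure μ]

theorem ae_mem_of_sparseSign {X : Ω → ℝ} (hX : Measurable X) {ρ : ℝ}
    (hp : μ.real {ω | X ω = 1} = ρ / 2) (hm : μ.real {ω | X ω = -1} = ρ / 2)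
    (hz : μ.real {ω | X ω = 0} = 1 - ρ) : ∀ᵐ ω ∂μ, X ω = 1 ∨ X ω = -1 ∨ X ω = 0 := by
  have m (a : ℝ) : MeasurableSet {ω | X ω = a} := hX (measurableSet_singleton a)
  have hd1 : Disjoint {ω | X ω = -1} {ω | X ω = 0} := by
    rw [Set.disjoint_left]; intro ω h h'; simp only [Set.mem_ofPred_eq] at h h'; linarith
  have hd2 : Disjoint {ω | X ω = 1} ({ω | X ω = -1} ∪ {ω | X ω = 0}) := by
    rw [Set.disjoint_left]
    rintro ω h (h' | h') <;> simp only [Set.mem_ofPred_eq] at h h' <;> linarith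
  have h1 : μ.real ({ω | X ω = 1} ∪ ({ω | X ω = -1} ∪ {ω | X ω = 0})) = 1 := by
    rw [measureReal_union hd2 ((m _).union (m _)), measureReal_union hd1 (m _), hp, hm, hz]
    ring
  have h2 : μ ({ω | X ω = 1} ∪ ({ω | X ω = -1} ∪ {ω | X ω = 0})) = 1 := by
    rw [← ENNReal.toReal_eq_one_iff]; exact h1
  exact (mem_ae_iff_prob_eq_one ((m _).union ((m _).union (m _)))).2 h2

theorem hasSubgaussianMGF_sparseSign {X : Ω → ℝ} (hX : Measurable X) {ρ : ℝ}
    (h0 : 0 < ρ) (h1 : ρ ≤ 1)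
    (hp : μ.real {ω | X ω = 1} = ρ / 2) (hm : μ.real {ω | X ω = -1} = ρ / 2)
    (hz : μ.real {ω | X ω = 0} = 1 - ρ) :
    HasSubgaussianMGF X (sparseSignProxy ρ).toNNReal μ := by
  have m (a : ℝ) : MeasurableSet {ω | X ω = a} := hX (measurableSet_singleton a)
  have hae (t : ℝ) : (fun ω => Real.exp (t * X ω)) =ᵐ[μ] fun ω =>
      {ω | X ω = 1}.indicator (fun _ => Real.exp t) ω +
      {ω | X ω = -1}.indicator (fun _ => Real.exp (-t)) ω +
      {ω | X ω = 0}.indicator (fun _ => (1 : ℝ)) ω := by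
    filter_upwards [ae_mem_of_sparseSign hX hp hm hz] with ω hω
    rcases hω with h | h | h <;> simp [Set.indicator, h] <;> norm_num
  have hint (a b : ℝ) : Integrable ({ω | X ω = a}.indicator fun _ => b) μ :=
    (integrable_const b).indicator (m a)
  refine ⟨fun t => ?_, fun t => ?_⟩
  · exact (((hint _ _).add (hint _ _)).add (hint _ _)).congr (hae t).symm
  · rw [mgf, integral_congr_ae (hae t),
      integral_add (f := fun ω => {ω | X ω = 1}.indicator (fun _ => Real.exp t) ω +
        {ω | X ω = -1}.indicator (fun _ => Real.exp (-t)) ω)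
        ((hint _ _).add (hint _ _)) (hint _ _),
      integral_add (hint _ _) (hint _ _), integral_indicator_const _ (m _),
      integral_indicator_const _ (m _), integral_indicator_const _ (m _), hp, hm, hz,
      Real.coe_toNNReal _ (sparseSignProxy_pos ρ).le]
    refine le_of_eq_of_le ?_ (one_sub_add_mul_cosh_le h0 h1 t)
    rw [Real.cosh_eq]
    simp only [smul_eq_mul]
    ring

theorem IsBernoulliSignTensor.measure_sum_ge_le {n₁ n₂ n₃ : ℕ} {ρ : ℝ}
    {M : Ω → Tensor3 n₁ n₂ n₃} (hM : IsBernoulliSignTensor μ ρ M) (h0 : 0 < ρ) (h1 : ρ ≤ 1)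
    {β : ℝ} (hβ : 0 ≤ β) {u : EuclideanSpace ℝ (Fin n₁)}
    {v : EuclideanSpace ℝ (Fin n₂)} {a : Fin n₃ → ℝ} (hu : ‖u‖ ≤ 1) (hv : ‖v‖ ≤ 1)
    (ha : ∀ k, |a k| ≤ 1) :
    μ.real {ω | β ≤ ∑ p : Fin n₁ × Fin n₂ × Fin n₃,
      (u p.1 * v p.2.1 * a p.2.2) * M ω p.1 p.2.1 p.2.2} ≤
      Real.exp (-β ^ 2 / (2 * (n₃ * sparseSignProxy ρ))) := by
  let b : Fin n₁ × Fin n₂ × Fin n₃ → ℝ := fun p => u p.1 * v p.2.1 * a p.2.2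
  have hK := sparseSignProxy_pos ρ
  have hind : iIndepFun (fun (p : Fin n₁ × Fin n₂ × Fin n₃) ω => b p * M ω p.1 p.2.1 p.2.2) μ :=
    hM.indep.comp (fun p x => b p * x) fun p => measurable_const_mul (b p)
  have hterm (p : Fin n₁ × Fin n₂ × Fin n₃) : HasSubgaussianMGF
      (fun ω => b p * M ω p.1 p.2.1 p.2.2) (b p ^ 2 * sparseSignProxy ρ).toNNReal μ := by
    refine ((hasSubgaussianMGF_sparseSign (hM.measurable_entry _ _ _) h0 h1 (hM.prob_one _ _ _)
      (hM.prob_neg_one _ _ _) (hM.prob_zero _ _ _)).const_mul (b p)).mono_const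
      (NNReal.eq ?_).le
    change b p ^ 2 * ((sparseSignProxy ρ).toNNReal : ℝ) = _
    rw [Real.coe_toNNReal _ hK.le, Real.coe_toNNReal _ (by positivity)]
  have hsum := HasSubgaussianMGF.sum_of_iIndepFun hind (s := Finset.univ) fun p _ => hterm p
  -- The weights form a product, so the sum of squares factors; only `a` contributes more than 1.
  have hb : ∑ p, b p ^ 2 ≤ n₃ := by
    have e : ∑ p, b p ^ 2 = ‖u‖ ^ 2 * (‖v‖ ^ 2 * ∑ k, a k ^ 2) := by
      rw [EuclideanSpace.real_norm_sq_eq, EuclideanSpace.real_norm_sq_eq, Finset.sum_mul_sum,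
        Finset.sum_mul_sum]
      simp only [Fintype.sum_prod_type, b, mul_pow, Finset.mul_sum, mul_assoc]
    have hA : ∑ k, a k ^ 2 ≤ n₃ := by
      calc ∑ k, a k ^ 2 ≤ ∑ _k : Fin n₃, (1 : ℝ) :=
            Finset.sum_le_sum fun k _ => (sq_le_one_iff_abs_le_one _).2 (ha k)
        _ = n₃ := by simp
    have hA0 : 0 ≤ ∑ k, a k ^ 2 := Finset.sum_nonneg fun _ _ => sq_nonneg _
    rw [e]
    calc _ ≤ 1 * (1 * ∑ k, a k ^ 2) := by
          gcongr <;> exact pow_le_one₀ (norm_nonneg _) ‹_›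
      _ ≤ n₃ := by linarith
  have hle := hsum.mono_const (d := ((n₃ : ℝ) * sparseSignProxy ρ).toNNReal) <| by
    rw [← Real.toNNReal_sum_of_nonneg fun p _ => by positivity, ← Finset.sum_mul]
    gcongr
  have h := hle.measure_ge_le hβ
  rwa [Real.coe_toNNReal _ (by positivity)] at h

end Subgaussian

/-! ### Union bound and choice of constants -/

theorem IsBernoulliSignTensor.measure_le_tensorSpectralNorm {Ω : Type*} [MeasurableSpace Ω]
    {μ : Measure Ω} [IsProbabilityMeasure μ] {n₁ n₂ n₃ : ℕ} [NeZero n₃] {ρ : ℝ}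
    {M : Ω → Tensor3 n₁ n₂ n₃} (hM : IsBernoulliSignTensor μ ρ M) (h0 : 0 < ρ) (h1 : ρ ≤ 1)
    {β : ℝ} (hβ : 0 ≤ β) :
    1 - n₃ * (5 ^ n₁ * 5 ^ n₂) * (2 * Real.exp (-β ^ 2 / (2 * (n₃ * sparseSignProxy ρ)))) ≤
      μ.real {ω | tensorSpectralNorm (M ω) ≤ 8 * β} := by
  obtain ⟨s, hscard, hs, hsnet⟩ := exists_half_net (EuclideanSpace ℝ (Fin n₁))
  obtain ⟨t, htcard, ht, htnet⟩ := exists_half_net (EuclideanSpace ℝ (Fin n₂))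
  rw [finrank_euclideanSpace_fin] at hscard htcard
  let bad (a : Fin n₃ → ℝ) (u : EuclideanSpace ℝ (Fin n₁)) (v : EuclideanSpace ℝ (Fin n₂)) :
      Set Ω := {ω | β ≤ ∑ p : Fin n₁ × Fin n₂ × Fin n₃,
        (u p.1 * v p.2.1 * a p.2.2) * M ω p.1 p.2.1 p.2.2}
  let I : Finset (AddChar (Fin n₃) ℂ × EuclideanSpace ℝ (Fin n₁) × EuclideanSpace ℝ (Fin n₂)) :=
    Finset.univ ×ˢ s ×ˢ t
  let Bad : Set Ω := ⋃ q ∈ I,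
    (bad (fun k => (q.1 k).re) q.2.1 q.2.2 ∪ bad (fun k => (q.1 k).im) q.2.1 q.2.2)
  have hBad : μ.real Bad ≤ n₃ * (5 ^ n₁ * 5 ^ n₂) *
      (2 * Real.exp (-β ^ 2 / (2 * (n₃ * sparseSignProxy ρ)))) := by
    refine (measureReal_biUnion_finset_le _ _).trans ?_
    refine (Finset.sum_le_card_nsmul _ _
      (2 * Real.exp (-β ^ 2 / (2 * (n₃ * sparseSignProxy ρ)))) fun q hq => ?_).trans ?_
    · obtain ⟨-, hu, hv⟩ : q.1 ∈ Finset.univ ∧ q.2.1 ∈ s ∧ q.2.2 ∈ t := by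
        simpa [I] using hq
      have hre := hM.measure_sum_ge_le h0 h1 hβ (hs _ hu) (ht _ hv) (a := fun k => (q.1 k).re)
        fun k => (Complex.abs_re_le_norm _).trans (q.1.norm_apply k).le
      have him := hM.measure_sum_ge_le h0 h1 hβ (hs _ hu) (ht _ hv) (a := fun k => (q.1 k).im)
        fun k => (Complex.abs_im_le_norm _).trans (q.1.norm_apply k).le
      exact (measureReal_union_le _ _).trans (by linarith)
    · rw [nsmul_eq_mul]
      gcongr
      simp only [I, Finset.card_product, Finset.card_univ, AddChar.card_eq, Fintype.card_fin]
      push_cast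
      gcongr <;> exact_mod_cast ‹_›
  -- Covering the whole space and using subadditivity avoids any measurability of the norm event.
  have hcover : Set.univ ⊆ {ω | tensorSpectralNorm (M ω) ≤ 8 * β} ∪ Bad := by
    intro ω _
    by_cases hω : ω ∈ Bad
    · exact Or.inr hω
    · left
      have hgood : ∀ ψ : AddChar (Fin n₃) ℂ, ∀ u ∈ s, ∀ v ∈ t,
          ω ∉ bad (fun k => (ψ k).re) u v ∧ ω ∉ bad (fun k => (ψ k).im) u v := by
        intro ψ u hu v hv
        rw [← not_or]
        exact fun h => hω (Set.mem_biUnion (x := (ψ, u, v)) (by simp [I, hu, hv]) h)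
      exact tensorSpectralNorm_le_of_net (M ω) hβ hsnet htnet
        (fun ψ u hu v hv => (not_le.1 (hgood ψ u hu v hv).1).le)
        (fun ψ u hu v hv => (not_le.1 (hgood ψ u hu v hv).2).le)
  have h := (measureReal_mono (μ := μ) hcover).trans (measureReal_union_le _ _)
  rw [probReal_univ] at h
  linarith

theorem mainTheorem8 :
    ∀ c : ℝ, 0 < c →
      ∃ φ : ℝ → ℝ, Tendsto φ (𝓝[>] 0) (𝓝 0) ∧
        ∀ (ρ : ℝ), 0 < ρ → ρ ≤ 1 →
        ∀ (n n₃ : ℕ), 0 < n → 0 < n₃ →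
        ∀ {Ω : Type*} [MeasurableSpace Ω] (μ : Measure Ω) [IsProbabilityMeasure μ]
          (M : Ω → Tensor3 n n n₃), IsBernoulliSignTensor μ ρ M →
          1 - (n₃ : ℝ) * Real.exp (-c * n) ≤
            μ.real {ω | tensorSpectralNorm (M ω) ≤ φ ρ * √((n : ℝ) * n₃)} := by
  intro c hc
  -- `128 = 8 ^ 2 * 2`: the 8 is the net and Fourier loss, the 2 comes from the tail exponent. The 4
  -- in `c + 4` pays for the nets.
  refine ⟨fun ρ => √(128 * (c + 4) * sparseSignProxy ρ), ?_, ?_⟩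
  · have h := (Real.continuous_sqrt.tendsto _).comp
      (tendsto_sparseSignProxy.const_mul (128 * (c + 4)))
    rwa [mul_zero, Real.sqrt_zero] at h
  intro ρ h0 h1 n n₃ hn hn₃ Ω _ μ _ M hM
  have : NeZero n₃ := ⟨hn₃.ne'⟩
  have hK := sparseSignProxy_pos ρ
  have hN : (0 : ℝ) < n₃ := by exact_mod_cast hn₃
  have hn1 : (1 : ℝ) ≤ n := by exact_mod_cast hn
  set β := √(128 * (c + 4) * sparseSignProxy ρ) * √((n : ℝ) * n₃) / 8 with hβ
  have h := hM.measure_le_tensorSpectralNorm h0 h1 (β := β) (by positivity)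
  rw [show 8 * β = √(128 * (c + 4) * sparseSignProxy ρ) * √((n : ℝ) * n₃) by rw [hβ]; ring] at h
  refine le_trans ?_ h
  have hexp : -β ^ 2 / (2 * (n₃ * sparseSignProxy ρ)) = -c * n + -4 * n := by
    rw [hβ, div_pow, mul_pow, Real.sq_sqrt (by positivity), Real.sq_sqrt (by positivity)]
    field_simp
    ring
  -- As `n ≥ 1`, `2 * 25 ^ n ≤ 50 ^ n`, and `50 ≤ exp 4`.
  have h50 : (5 : ℝ) ^ n * 5 ^ n * 2 * Real.exp (-4 * n) ≤ 1 := by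
    have h4 : (50 : ℝ) ≤ Real.exp 4 := by
      have h27 := Real.exp_one_gt_d9
      have h4' : Real.exp 4 = Real.exp 1 ^ 4 := by rw [← Real.exp_nat_mul]; norm_num
      rw [h4']
      calc (50 : ℝ) ≤ 2.7 ^ 4 := by norm_num
        _ ≤ Real.exp 1 ^ 4 := by gcongr; linarith
    have h2 : (2 : ℝ) ≤ 2 ^ n := le_self_pow₀ one_le_two hn.ne'
    calc (5 : ℝ) ^ n * 5 ^ n * 2 * Real.exp (-4 * n)
        ≤ 5 ^ n * 5 ^ n * 2 ^ n * Real.exp (-4 * n) := by gcongr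
      _ = 50 ^ n * Real.exp (-4 * n) := by rw [← mul_pow, ← mul_pow]; norm_num
      _ ≤ Real.exp 4 ^ n * Real.exp (-4 * n) := by gcongr
      _ = 1 := by rw [← Real.exp_nat_mul, ← Real.exp_add]; simp [mul_comm]
  rw [hexp, Real.exp_add]
  have := mul_le_mul_of_nonneg_left h50 (by positivity : 0 ≤ n₃ * Real.exp (-c * n))
  linarith
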